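/- **Theorem 5.3 (Regularity lemma for abelian groups).** Let $G$ be a finite abelian group, $N=|G|$, and let $G^*$ be the group of characters of $G$. Identify a set with its characteristic function, and for $f,g:G\to\mathbb{R}$ and $\gamma\in G^*$ put $f*g(x)=\sum_{y\in G}f(y)g(x-y)$ and $\widehat f(\gamma)=\sum_{x\in G} f(x)\gamma(x)$. For a finite set $\Gamma\subseteq G^*$ and $\delta>0$, let $B_{\Gamma,\delta}=\{x\in G: |\arg\gamma(x)|\le 2\pi\delta \text{ for all }\gamma\in\Gamma\}$, where $\arg$ takes values in $(-\pi,\pi]$, and put $$\widetilde B_{\Gamma,\delta}(x)=\int_0^\infty B_{\Gamma,t}(x)\frac{e^{-t/\delta}}{\delta}\,dt,\qquad \beta_{\Gamma,\delta}=\frac{\widetilde B_{\Gamma,\delta}}{\sum_{y\in G}|\widetilde B_{\Gamma,\delta}(y)|},\qquad \psi_{\Gamma,\delta}=\beta_{\Gamma,\delta}*\beta_{\Gamma,\delta}.$$ Let $k\ge 1$ be an integer and let $\epsilon>0$. Given a nonempty set $R\subseteq G^*$ with $|R|=d$ and $\eta\in(0,1)$, write $\psi_1=\psi_{R,\eta}$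 and $\psi_2=\psi_{R,\eta_2}$, where $\eta_2=2^{-40}\epsilon^6\eta/(dk^4)$. For $A\subseteq G$ and $x\in G$ write $\alpha_1^x=A*\psi_1(x)$, $\alpha_2^x=A*\psi_2(x)$ and $A^{+x}(n)=A(x+n)$. Call $x$ an *$\epsilon$-regular value* with respect to $A$ and $(R,\eta)$ if $$\sum_{y\in G}(\alpha_2^{x+y}-\alpha_1^x)^2\psi_1(y)\le\epsilon^2\qquad\text{and}\qquad \sup_{\gamma\in G^*}\left|\left((A^{+x}-\alpha_2^x)\psi_2\right)^{\wedge}(\gamma)\right|\le\epsilon,$$ and say that $(R,\eta)$ is *$\epsilon$-regular* for $A$ if fewer than $\epsilon N$ elements $x\in G$ fail to be $\epsilon$-regular values. Let $W(t)$ denote a tower of twos of height $\lceil t\rceil$ (height $0$ giving $1$, height $h+1$ giving $2$ to the power of the tower of height $h$). Then for all $A_1,\dots,A_k\subseteq G$ there are a nonempty set $R\subseteq G^*$ and $\eta\in(0,1)$ with $$|R|\le W(2^{11}k^2\epsilon^{-3})\qquad\text{and}\qquad \eta\ge \frac{1}{W(2^{11}k^2\epsilon^{-3})}$$ such that $(R,\eta)$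 is $\epsilon$-regular for $A_i$ for every $i=1,\dots,k$. -/

import Mathlib

open scoped BigOperators

noncomputable section

namespace AbelianRegularity

variable {G : Type*} [AddCommGroup G] [Fintype G]

/-- The tower of twos of height `n`: `1, 2, 2 ^ 2, 2 ^ (2 ^ 2), …`. -/
def tower : ℕ → ℕ
  | 0 => 1
  | n + 1 => 2 ^ tower n

/-- `W t` is a tower of twos of height `⌈t⌉`. -/
def W (t : ℝ) : ℝ := (tower ⌈t⌉₊ : ℝ)

/-- The characteristic function of a set `A`, as a real-valued function. -/
def ind (A : Set G) : G → ℝ := A.indicator 1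

/-- Convolution on `G` with respect to counting measure. -/
def conv (f g : G → ℝ) (x : G) : ℝ := ∑ y, f y * g (x - y)

/-- Fourier transform on `G` with respect to counting measure. -/
def fourier (f : G → ℝ) (γ : AddChar G ℂ) : ℂ := ∑ x, (f x : ℂ) * γ x

/-- The Bohr neighbourhood of width `δ` with frequency set `Γ`.
Here `Complex.arg` takes values in `(-π, π]`. -/
def bohr (Γ : Finset (AddChar G ℂ)) (δ : ℝ) : Set G :=
  {x | ∀ γ ∈ Γ, |Complex.arg (γ x)| ≤ 2 * Real.pi * δ}

/-- The (unnormalised) smoothed Bohr neighbourhood. -/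
def smoothBohr (Γ : Finset (AddChar G ℂ)) (δ : ℝ) (x : G) : ℝ :=
  ∫ t in Set.Ioi (0 : ℝ), ind (bohr Γ t) x * (Real.exp (-t / δ) / δ)

/-- The smoothed Bohr neighbourhood, normalised to have `ℓ¹` norm `1`. -/
def beta (Γ : Finset (AddChar G ℂ)) (δ : ℝ) (x : G) : ℝ :=
  smoothBohr Γ δ x / ∑ y, |smoothBohr Γ δ y|

/-- The smoothed Bohr cutoff `ψ_{Γ,δ} = β_{Γ,δ} ∗ β_{Γ,δ}`. -/
def psi (Γ : Finset (AddChar G ℂ)) (δ : ℝ) : G → ℝ :=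
  conv (beta Γ δ) (beta Γ δ)

/-- The second, much smaller, width `η₂ = 2⁻⁴⁰ ε⁶ η / (d k⁴)` attached to `(R, η)`, where `d = |R|`
and `k` is the number of sets under consideration. It is meaningful for nonempty `R`. -/
def eta2 (k : ℕ) (ε : ℝ) (R : Finset (AddChar G ℂ)) (η : ℝ) : ℝ :=
  2 ^ (-40 : ℤ) * ε ^ 6 * η / ((R.card : ℝ) * (k : ℝ) ^ 4)

/-- `ψ₁ = ψ_{R,η}`. -/
def psi1 (R : Finset (AddChar G ℂ)) (η : ℝ) : G → ℝ := psi R η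

/-- `ψ₂ = ψ_{R,η₂}`. -/
def psi2 (k : ℕ) (ε : ℝ) (R : Finset (AddChar G ℂ)) (η : ℝ) : G → ℝ :=
  psi R (eta2 k ε R η)

/-- The local density `α₁ˣ = (A ∗ ψ₁)(x)`. -/
def alpha1 (R : Finset (AddChar G ℂ)) (η : ℝ) (A : Set G) (x : G) : ℝ :=
  conv (ind A) (psi1 R η) x

/-- The local density `α₂ˣ = (A ∗ ψ₂)(x)`. -/
def alpha2 (k : ℕ) (ε : ℝ) (R : Finset (AddChar G ℂ)) (η : ℝ) (A : Set G) (x : G) : ℝ :=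
  conv (ind A) (psi2 k ε R η) x

/-- `x` is an `ε`-regular value with respect to `A` and the pair `(R, η)`: the local density is
stable around `x`, and all the Fourier coefficients of the balanced localised set at `x` are
small (in the second clause `A` is translated by `x`, i.e. `A⁺ˣ(n) = A(x + n)`). -/
structure IsRegularValue (k : ℕ) (ε : ℝ) (R : Finset (AddChar G ℂ)) (η : ℝ)
    (A : Set G) (x : G) : Prop where
  density_stable :
    ∑ y, (alpha2 k ε R η A (x + y) - alpha1 R η A x) ^ 2 * psi1 R η y ≤ ε ^ 2
  fourier_small : ∀ γ : AddChar G ℂ,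
    ‖fourier (fun n => (ind A (x + n) - alpha2 k ε R η A x) * psi2 k ε R η n) γ‖ ≤ ε

/-- `(R, η)` is `ε`-regular for `A`: fewer than `ε |G|` points fail to be `ε`-regular values. -/
def IsRegularPair (k : ℕ) (ε : ℝ) (R : Finset (AddChar G ℂ)) (η : ℝ) (A : Set G) : Prop :=
  (Set.ncard {x : G | ¬ IsRegularValue k ε R η A x} : ℝ) < ε * (Fintype.card G : ℝ)

end AbelianRegularity

end

/-!
The proof is an energy increment argument, with the energy of `f` at a pair `(R, η)` taken to be
`‖f ∗ ψ_{R,η}‖₂²`.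

The layer-cake formula turns the smoothed Bohr neighbourhood into an exponential weight,
`smoothBohr R δ x = exp (-‖x‖_R / δ)`, where `‖x‖_R = max_{γ ∈ R} |arg γ(x)| / 2π` is a seminorm
(`smoothBohr_eq_exp`). Hence translating `ψ_{R,δ}` by `y` changes it by at most `2 ‖y‖_R / δ` in
`ℓ¹` (`sum_abs_psi_add_sub_le`), and Jensen's inequality together with the doubling of Bohr
neighbourhoods shows that `‖y‖_R` has mean at most `8 δ |R|` under `ψ_{R,δ}`
(`sum_psi_mul_bohrNorm_le`). So if `R ⊆ S` and `δ' |S|` is much smaller than `δ`, then `ψ_{R,δ}`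
is almost invariant under translations drawn from `ψ_{S,δ'}`.

Almost invariance has two consequences. The local variance of `f ∗ ψ_{S,δ'}` around
`f ∗ ψ_{R,δ}` is bounded by the difference of the two energies, up to a small error
(`sum_variance_le`); in particular no set loses more than a negligible amount of energy. And a
large Fourier coefficient at `γ ∈ S` of the balanced localisation of `f` survives the
replacement of `f` by `f ∗ ψ_{S,δ'}`, so it forces a large local variance
(`norm_localFourier_sub_sq_le`).

Suppose that `(R, η)` is not `ε`-regular for some set. On at least `ε |G| / 2` points either the
local density is unstable, and the energy increases in passing from `ψ₁` to `ψ₂`; or there is a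
large local Fourier coefficient, and the energy increases in passing from `ψ₂` to `ψ_{S,η'}`, where
`S` adds to `R` one frequency for each point of a Bohr net in the exceptional set
(`exists_energy_increment`). In both cases the total energy of the `k` sets grows by
`ε³ |G| / 16`, and it never exceeds `k |G|`, so there are at most `16 k / ε³` steps. The size of the
net is exponential in `|R|`, and one step raises the tower bound on the parameters by two levels
(`growth_le`).
-/

namespace AbelianRegularity

variable {G : Type*} [AddCommGroup G]

/-! ### The Bohr seminorm -/

lemma abs_arg_exp_le (θ : ℝ) : |Complex.arg (Complex.exp (θ * Complex.I))| ≤ |θ| := by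
  by_cases h : θ ∈ Set.Ioc (-Real.pi) Real.pi
  · rw [Complex.arg_exp_mul_I, (toIocMod_eq_self Real.two_pi_pos).2
      ⟨h.1, by linarith [h.2]⟩]
  · refine (Complex.abs_arg_le_pi _).trans ?_
    by_contra! h'
    exact h ⟨(abs_lt.1 h').1, (abs_lt.1 h').2.le⟩

lemma abs_arg_neg (γ : AddChar G ℂ) (x : G) : |(γ (-x)).arg| = |(γ x).arg| := by
  rw [AddChar.map_neg_eq_inv, Complex.abs_arg_inv]

/-- The seminorm `x ↦ max_{γ ∈ R} |arg γ(x)| / 2π` on `G`, whose balls are the Bohr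
neighbourhoods with frequency set `R`. The supremum is taken in `ℝ≥0`, so it is `0` for
`R = ∅`. -/
noncomputable def bohrNorm (R : Finset (AddChar G ℂ)) (x : G) : ℝ :=
  (R.sup fun γ => Real.nnabs ((γ x).arg / (2 * Real.pi)) : NNReal)

lemma bohrNorm_nonneg (R : Finset (AddChar G ℂ)) (x : G) : 0 ≤ bohrNorm R x :=
  NNReal.coe_nonneg _

lemma bohrNorm_le_iff (R : Finset (AddChar G ℂ)) (x : G) {t : ℝ} (ht : 0 ≤ t) :
    bohrNorm R x ≤ t ↔ ∀ γ ∈ R, |(γ x).arg| ≤ 2 * Real.pi * t := by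
  lift t to NNReal using ht
  rw [bohrNorm, NNReal.coe_le_coe, Finset.sup_le_iff]
  refine forall₂_congr fun γ _ => ?_
  rw [← NNReal.coe_le_coe, Real.coe_nnabs, abs_div, abs_of_pos Real.two_pi_pos,
    div_le_iff₀' Real.two_pi_pos]

lemma abs_arg_le_bohrNorm {R : Finset (AddChar G ℂ)} {γ : AddChar G ℂ} (hγ : γ ∈ R) (x : G) :
    |(γ x).arg| ≤ 2 * Real.pi * bohrNorm R x :=
  (bohrNorm_le_iff R x (bohrNorm_nonneg R x)).1 le_rfl γ hγ

lemma bohrNorm_neg (R : Finset (AddChar G ℂ)) (x : G) : bohrNorm R (-x) = bohrNorm R x := by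
  have h : ∀ z : G, bohrNorm R (-z) ≤ bohrNorm R z := fun z =>
    (bohrNorm_le_iff R _ (bohrNorm_nonneg R z)).2 fun γ hγ => by
      rw [abs_arg_neg]
      exact abs_arg_le_bohrNorm hγ z
  exact le_antisymm (h x) (by simpa using h (-x))

lemma bohrNorm_mono {R S : Finset (AddChar G ℂ)} (h : R ⊆ S) (x : G) :
    bohrNorm R x ≤ bohrNorm S x :=
  (bohrNorm_le_iff R x (bohrNorm_nonneg S x)).2 fun _ hγ => abs_arg_le_bohrNorm (h hγ) x

lemma bohrNorm_le_half (R : Finset (AddChar G ℂ)) (x : G) : bohrNorm R x ≤ 1 / 2 :=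
  (bohrNorm_le_iff R x (by norm_num)).2 fun γ _ => by
    linarith [Complex.abs_arg_le_pi (γ x)]

/-! ### Cells of the torus -/

/-- The torus cell of side `t` (in units of full turns) that contains the point
`(γ x)_{γ ∈ R}`. -/
noncomputable def bohrCell (R : Finset (AddChar G ℂ)) (t : ℝ) (x : G) : R → ℤ :=
  fun γ => ⌊(γ.1 x).arg / (2 * Real.pi * t)⌋

lemma bohrCell_mem {R : Finset (AddChar G ℂ)} {t : ℝ} (ht : 0 < t) {x : G} {M : ℕ}
    (h : bohrNorm R x ≤ M * t) :
    bohrCell R t x ∈ Fintype.piFinset fun _ : R => Finset.Icc (-(M : ℤ)) M := by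
  have hp : 0 < 2 * Real.pi * t := mul_pos Real.two_pi_pos ht
  rw [Fintype.mem_piFinset]
  intro γ
  have h1 := (bohrNorm_le_iff R x (by positivity)).1 h γ.1 γ.2
  have h2 : |(γ.1 x).arg / (2 * Real.pi * t)| ≤ M := by
    rw [abs_div, abs_of_pos hp, div_le_iff₀ hp]
    linarith
  rw [abs_le] at h2
  rw [Finset.mem_Icc, bohrCell]
  constructor
  · rw [Int.le_floor]
    push_cast
    exact h2.1
  · exact_mod_cast (Int.floor_le _).trans h2.2

lemma card_piFinset_Icc (R : Finset (AddChar G ℂ)) (M : ℕ) :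
    (Fintype.piFinset fun _ : R => Finset.Icc (-(M : ℤ)) M).card = (2 * M + 1) ^ R.card := by
  rw [Fintype.card_piFinset, Finset.prod_const, Finset.card_univ, Int.card_Icc, Fintype.card_coe]
  congr 1
  omega

/-! ### Smoothed Bohr neighbourhoods as exponential weights -/

lemma integrableOn_exp_neg_div {δ : ℝ} (hδ : 0 < δ) (c : ℝ) :
    MeasureTheory.IntegrableOn (fun t => Real.exp (-t / δ) / δ) (Set.Ioi c) := by
  have h := (exp_neg_integrableOn_Ioi c (inv_pos.2 hδ)).div_const δ
  refine h.congr (Filter.Eventually.of_forall fun t => ?_)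
  simp only
  congr 2
  field_simp

lemma indicator_mul_exp (δ c : ℝ) :
    (fun t => (Set.Ici c).indicator (1 : ℝ → ℝ) t * (Real.exp (-t / δ) / δ)) =
      (Set.Ici c).indicator fun t => Real.exp (-t / δ) / δ := by
  funext t
  by_cases h : t ∈ Set.Ici c <;> simp [h]

/-- The layer-cake formula for the exponential weight. -/
lemma integral_indicator_exp {δ c : ℝ} (hδ : 0 < δ) (hc : 0 ≤ c) :
    ∫ t in Set.Ioi (0 : ℝ), (Set.Ici c).indicator 1 t * (Real.exp (-t / δ) / δ) =
      Real.exp (-c / δ) := by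
  rw [indicator_mul_exp, MeasureTheory.setIntegral_indicator measurableSet_Ici]
  have h2 : (Set.Ioi (0 : ℝ) ∩ Set.Ici c : Set ℝ) =ᵐ[MeasureTheory.volume] Set.Ioi c := by
    have h3 : (Set.Ioi (0 : ℝ) ∩ Set.Ici c : Set ℝ) =ᵐ[MeasureTheory.volume]
        (Set.Ioi 0 ∩ Set.Ioi c : Set ℝ) :=
      Filter.EventuallyEq.rfl.inter MeasureTheory.Ioi_ae_eq_Ici.symm
    rwa [Set.Ioi_inter_Ioi, sup_eq_right.2 hc] at h3
  rw [MeasureTheory.setIntegral_congr_set h2]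
  have h4 : (fun t => Real.exp (-t / δ) / δ) = fun t => Real.exp (-δ⁻¹ * t) / δ := by
    funext t
    congr 2
    field_simp
  rw [h4, MeasureTheory.integral_div, integral_exp_mul_Ioi (by simpa using hδ)]
  have h5 : -δ⁻¹ * c = -c / δ := by field_simp
  rw [h5]
  field_simp

lemma integrableOn_indicator_exp {δ : ℝ} (hδ : 0 < δ) (c : ℝ) :
    MeasureTheory.IntegrableOn
      (fun t => (Set.Ici c).indicator 1 t * (Real.exp (-t / δ) / δ)) (Set.Ioi (0 : ℝ)) := by
  rw [indicator_mul_exp]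
  exact MeasureTheory.Integrable.indicator (integrableOn_exp_neg_div hδ 0) measurableSet_Ici

lemma smoothBohr_eq_exp (R : Finset (AddChar G ℂ)) {δ : ℝ} (hδ : 0 < δ) (x : G) :
    smoothBohr R δ x = Real.exp (-bohrNorm R x / δ) := by
  rw [← integral_indicator_exp hδ (bohrNorm_nonneg R x), smoothBohr]
  refine MeasureTheory.setIntegral_congr_fun measurableSet_Ioi fun t ht => ?_
  simp only [ind]
  congr 1
  have : x ∈ bohr R t ↔ t ∈ Set.Ici (bohrNorm R x) :=
    (bohrNorm_le_iff R x (le_of_lt ht)).symm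
  by_cases h : x ∈ bohr R t
  · simp [h, this.1 h, - Set.mem_Ici]
  · simp [h, mt this.2 h, - Set.mem_Ici]

/-! ### Subadditivity of the Bohr seminorm -/

variable [Fintype G]

lemma exp_arg_mul_I (γ : AddChar G ℂ) (x : G) :
    Complex.exp ((γ x).arg * Complex.I) = γ x := by
  simpa using Complex.norm_mul_exp_arg_mul_I (γ x)

lemma abs_arg_add_le (γ : AddChar G ℂ) (x y : G) :
    |(γ (x + y)).arg| ≤ |(γ x).arg| + |(γ y).arg| := by
  have h : γ (x + y) = Complex.exp ((((γ x).arg + (γ y).arg : ℝ) : ℂ) * Complex.I) := by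
    push_cast
    rw [add_mul, Complex.exp_add, exp_arg_mul_I, exp_arg_mul_I, AddChar.map_add_eq_mul]
  rw [h]
  exact (abs_arg_exp_le _).trans (abs_add_le _ _)

lemma abs_arg_sub_le (γ : AddChar G ℂ) (x y : G) :
    |(γ (x - y)).arg| ≤ |(γ x).arg - (γ y).arg| := by
  have h : γ (x - y) = Complex.exp ((((γ x).arg - (γ y).arg : ℝ) : ℂ) * Complex.I) := by
    push_cast
    rw [sub_mul, Complex.exp_sub, exp_arg_mul_I, exp_arg_mul_I, AddChar.map_sub_eq_div]
  rw [h]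
  exact abs_arg_exp_le _

lemma bohrNorm_add_le (R : Finset (AddChar G ℂ)) (x y : G) :
    bohrNorm R (x + y) ≤ bohrNorm R x + bohrNorm R y := by
  refine (bohrNorm_le_iff R _ (add_nonneg (bohrNorm_nonneg R x) (bohrNorm_nonneg R y))).2
    fun γ hγ => (abs_arg_add_le γ x y).trans ?_
  linarith [abs_arg_le_bohrNorm hγ x, abs_arg_le_bohrNorm hγ y]

lemma norm_sub_one_le_bohrNorm {R : Finset (AddChar G ℂ)} {γ : AddChar G ℂ} (hγ : γ ∈ R)
    (x : G) : ‖γ x - 1‖ ≤ 2 * Real.pi * bohrNorm R x := by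
  rw [← exp_arg_mul_I γ x, mul_comm]
  exact Real.norm_exp_I_mul_ofReal_sub_one_le.trans (abs_arg_le_bohrNorm hγ x)

lemma abs_bohrNorm_add_sub_le (R : Finset (AddChar G ℂ)) (x y : G) :
    |bohrNorm R (x + y) - bohrNorm R x| ≤ bohrNorm R y := by
  have h := bohrNorm_add_le R (x + y) (-y)
  rw [add_neg_cancel_right, bohrNorm_neg] at h
  rw [abs_le]
  constructor <;> linarith [bohrNorm_add_le R x y]

/-! ### Covering by Bohr neighbourhoods -/

lemma bohrNorm_sub_le_of_bohrCell_eq {R : Finset (AddChar G ℂ)} {t : ℝ} (ht : 0 < t) {x y : G}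
    (h : bohrCell R t x = bohrCell R t y) : bohrNorm R (x - y) ≤ t := by
  have hp : 0 < 2 * Real.pi * t := mul_pos Real.two_pi_pos ht
  refine (bohrNorm_le_iff R _ ht.le).2 fun γ hγ => (abs_arg_sub_le γ x y).trans ?_
  have h1 := Int.abs_sub_lt_one_of_floor_eq_floor (congrFun h ⟨γ, hγ⟩)
  rw [← sub_div, abs_div, abs_of_pos hp, div_lt_one hp] at h1
  exact h1.le

/-- Every subset `X` of `G` has a `t`-net of at most `(1 / t + 3) ^ |R|` points of `X`: one
representative is chosen in each torus cell that `X` meets. -/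
lemma exists_bohr_net (R : Finset (AddChar G ℂ)) {t : ℝ} (ht : 0 < t) (X : Finset G) :
    ∃ T ⊆ X, (T.card : ℝ) ≤ (1 / t + 3) ^ R.card ∧
      ∀ x ∈ X, ∃ y ∈ T, bohrNorm R (x - y) ≤ t := by
  classical
  obtain ⟨T, hTX, hinj, himg⟩ :=
    Finset.exists_subset_injOn_image_eq_of_surjOn X (X.image (bohrCell R t))
      (f := bohrCell R t) (fun z hz => by simpa using hz)
  refine ⟨T, hTX, ?_, fun x hx => ?_⟩
  · set M : ℕ := ⌈1 / (2 * t)⌉₊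
    have h1 : T.card ≤ (2 * M + 1) ^ R.card := by
      rw [← card_piFinset_Icc, ← Finset.card_image_of_injOn hinj, himg]
      refine Finset.card_le_card fun z hz => ?_
      obtain ⟨x, _, rfl⟩ := Finset.mem_image.1 hz
      refine bohrCell_mem ht ((bohrNorm_le_half R x).trans ?_)
      have := Nat.le_ceil (1 / (2 * t))
      rw [div_le_iff₀ (by positivity)] at this
      linarith
    calc (T.card : ℝ) ≤ (2 * (M : ℝ) + 1) ^ R.card := by exact_mod_cast h1
      _ ≤ _ := by
        refine pow_le_pow_left₀ (by positivity) ?_ _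
        have := Nat.ceil_lt_add_one (a := 1 / (2 * t)) (by positivity)
        have h2 : 2 * (1 / (2 * t)) = 1 / t := by field_simp
        change (M : ℝ) < _ at this
        linarith
  · have : bohrCell R t x ∈ T.image (bohrCell R t) := himg ▸ Finset.mem_image_of_mem _ hx
    obtain ⟨y, hy, hxy⟩ := Finset.mem_image.1 this
    exact ⟨y, hy, bohrNorm_sub_le_of_bohrCell_eq ht hxy.symm⟩

/-- Doubling for Bohr neighbourhoods: dilating by `2` costs a factor `5` per frequency. -/
lemma card_bohrNorm_le_two_mul [DecidableEq G] (R : Finset (AddChar G ℂ)) {t : ℝ} (ht : 0 < t) :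
    (Finset.univ.filter fun x => bohrNorm R x ≤ 2 * t).card ≤
      5 ^ R.card * (Finset.univ.filter fun x => bohrNorm R x ≤ t).card := by
  classical
  rw [mul_comm (5 ^ _)]
  refine (Finset.card_le_mul_card_image (f := bohrCell R t) _
    (Finset.univ.filter fun x => bohrNorm R x ≤ t).card ?_).trans
    (Nat.mul_le_mul_left _ ?_)
  · intro b hb
    obtain ⟨y, _, rfl⟩ := Finset.mem_image.1 hb
    refine Finset.card_le_card_of_injOn (fun x => x - y) (fun x hx => ?_)
      (fun _ _ _ _ h => sub_left_injective h)
    simp only [Finset.coe_filter, Finset.mem_filter, Finset.mem_univ, true_and,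
      Set.mem_ofPred_eq] at hx ⊢
    exact bohrNorm_sub_le_of_bohrCell_eq ht hx.2
  · calc _ ≤ (Fintype.piFinset fun _ : R => Finset.Icc (-((2 : ℕ) : ℤ)) (2 : ℕ)).card := by
          refine Finset.card_le_card fun z hz => ?_
          obtain ⟨x, hx, rfl⟩ := Finset.mem_image.1 hz
          exact bohrCell_mem ht (by simpa using hx)
      _ = 5 ^ R.card := by rw [card_piFinset_Icc]

/-! ### The normalised weight -/

lemma sum_exp_bohrNorm_pos (R : Finset (AddChar G ℂ)) (δ : ℝ) :
    0 < ∑ x, Real.exp (-bohrNorm R x / δ) :=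
  Finset.sum_pos (fun _ _ => Real.exp_pos _) ⟨0, Finset.mem_univ _⟩

lemma sum_exp_half_bohrNorm_le (R : Finset (AddChar G ℂ)) {δ : ℝ} (hδ : 0 < δ) :
    ∑ x, Real.exp (-(bohrNorm R x / 2) / δ) ≤
      5 ^ R.card * ∑ x, Real.exp (-bohrNorm R x / δ) := by
  classical
  have key : ∀ c : G → ℝ, (∀ x, 0 ≤ c x) → ∑ x, Real.exp (-c x / δ) =
      ∫ t in Set.Ioi (0 : ℝ),
        ((Finset.univ.filter fun x => c x ≤ t).card : ℝ) * (Real.exp (-t / δ) / δ) := by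
    intro c hc
    simp_rw [← fun x => integral_indicator_exp hδ (hc x)]
    rw [← MeasureTheory.integral_finsetSum _ fun x _ => integrableOn_indicator_exp hδ (c x)]
    congr 1
    funext t
    rw [← Finset.sum_mul]
    simp [Set.indicator_apply, Finset.sum_boole]
  have hint : ∀ c : G → ℝ, MeasureTheory.IntegrableOn (fun t =>
      ((Finset.univ.filter fun x => c x ≤ t).card : ℝ) * (Real.exp (-t / δ) / δ))
      (Set.Ioi (0 : ℝ)) := by
    intro c
    have : (fun t => ((Finset.univ.filter fun x => c x ≤ t).card : ℝ) *
        (Real.exp (-t / δ) / δ)) =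
        fun t => ∑ x, (Set.Ici (c x)).indicator 1 t * (Real.exp (-t / δ) / δ) := by
      funext t
      rw [← Finset.sum_mul]
      simp [Set.indicator_apply, Finset.sum_boole]
    rw [this]
    exact MeasureTheory.integrable_finsetSum _ fun x _ => integrableOn_indicator_exp hδ (c x)
  rw [key _ fun x => by linarith [bohrNorm_nonneg R x], key _ (bohrNorm_nonneg R),
    ← MeasureTheory.integral_const_mul]
  refine MeasureTheory.setIntegral_mono_on (hint _) ((hint _).const_mul _) measurableSet_Ioi
    fun t ht => ?_
  rw [← mul_assoc]
  refine mul_le_mul_of_nonneg_right ?_ (by positivity)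
  have h := card_bohrNorm_le_two_mul R (Set.mem_Ioi.1 ht)
  simp_rw [div_le_iff₀' (zero_lt_two' ℝ)]
  exact_mod_cast h

lemma beta_eq (R : Finset (AddChar G ℂ)) {δ : ℝ} (hδ : 0 < δ) (x : G) :
    beta R δ x = Real.exp (-bohrNorm R x / δ) / ∑ y, Real.exp (-bohrNorm R y / δ) := by
  simp [beta, smoothBohr_eq_exp R hδ]

lemma beta_nonneg (R : Finset (AddChar G ℂ)) {δ : ℝ} (hδ : 0 < δ) (x : G) :
    0 ≤ beta R δ x := by
  rw [beta_eq R hδ]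
  exact div_nonneg (Real.exp_pos _).le (sum_exp_bohrNorm_pos R δ).le

lemma sum_beta (R : Finset (AddChar G ℂ)) {δ : ℝ} (hδ : 0 < δ) : ∑ x, beta R δ x = 1 := by
  simp_rw [beta_eq R hδ]
  rw [← Finset.sum_div, div_self (sum_exp_bohrNorm_pos R δ).ne']

lemma beta_neg (R : Finset (AddChar G ℂ)) {δ : ℝ} (hδ : 0 < δ) (x : G) :
    beta R δ (-x) = beta R δ x := by
  simp [beta_eq R hδ, bohrNorm_neg]

lemma abs_exp_neg_sub_exp_neg_le (u v : ℝ) :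
    |Real.exp (-u) - Real.exp (-v)| ≤ |u - v| * (Real.exp (-u) + Real.exp (-v)) := by
  wlog h : u ≤ v generalizing u v
  · rw [abs_sub_comm, abs_sub_comm u, add_comm]
    exact this v u (le_of_not_ge h)
  have h1 : Real.exp (-v) ≤ Real.exp (-u) := Real.exp_le_exp.2 (by linarith)
  rw [abs_of_nonneg (by linarith), abs_of_nonpos (by linarith)]
  have h2 : Real.exp (-v) = Real.exp (-u) * Real.exp (u - v) := by
    rw [← Real.exp_add]
    ring_nf
  have h3 := Real.add_one_le_exp (u - v)
  have h4 := Real.exp_pos (-u)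
  have h5 := Real.exp_pos (-v)
  have h6 : Real.exp (-u) * (u - v + 1) ≤ Real.exp (-v) := by
    rw [h2]
    exact mul_le_mul_of_nonneg_left h3 h4.le
  nlinarith [mul_nonneg (sub_nonneg.2 h) h5.le]

lemma sum_add_right_eq {M : Type*} [AddCommMonoid M] (f : G → M) (y : G) :
    ∑ x, f (x + y) = ∑ x, f x :=
  Equiv.sum_comp (Equiv.addRight y) f

lemma sum_sub_left_eq {M : Type*} [AddCommMonoid M] (f : G → M) (y : G) :
    ∑ x, f (y - x) = ∑ x, f x :=
  Equiv.sum_comp (Equiv.subLeft y) f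

lemma sum_sub_right_eq {M : Type*} [AddCommMonoid M] (f : G → M) (y : G) :
    ∑ x, f (x - y) = ∑ x, f x :=
  Equiv.sum_comp (Equiv.subRight y) f

lemma sum_abs_beta_add_sub_le (R : Finset (AddChar G ℂ)) {δ : ℝ} (hδ : 0 < δ) (y : G) :
    ∑ x, |beta R δ (x + y) - beta R δ x| ≤ 2 * bohrNorm R y / δ := by
  have h : ∀ x, |beta R δ (x + y) - beta R δ x| ≤
      bohrNorm R y / δ * (beta R δ (x + y) + beta R δ x) := by
    intro x
    have hS := sum_exp_bohrNorm_pos R δ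
    rw [beta_eq R hδ, beta_eq R hδ, ← sub_div, ← add_div, abs_div, abs_of_pos hS,
      ← mul_div_assoc]
    refine div_le_div_of_nonneg_right ?_ hS.le
    have := abs_exp_neg_sub_exp_neg_le (bohrNorm R (x + y) / δ) (bohrNorm R x / δ)
    rw [← sub_div, abs_div, abs_of_pos hδ] at this
    simp only [neg_div]
    refine this.trans (mul_le_mul_of_nonneg_right ?_ (by positivity))
    exact div_le_div_of_nonneg_right (abs_bohrNorm_add_sub_le R x y) hδ.le
  refine (Finset.sum_le_sum fun x _ => h x).trans_eq ?_
  rw [← Finset.mul_sum, Finset.sum_add_distrib, sum_add_right_eq (beta R δ), sum_beta R hδ]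
  ring

/-- The mean of the Bohr seminorm under `β` is `O(δ |R|)`: by Jensen's inequality its exponential
is at most the ratio of the total masses at the widths `2δ` and `δ`, which doubling controls. -/
lemma sum_beta_mul_bohrNorm_le (R : Finset (AddChar G ℂ)) {δ : ℝ} (hδ : 0 < δ) :
    ∑ x, beta R δ x * bohrNorm R x ≤ 4 * δ * R.card := by
  have hS := sum_exp_bohrNorm_pos R δ
  have hJ := convexOn_exp.map_sum_le (t := Finset.univ) (w := beta R δ)
    (p := fun x => bohrNorm R x / (2 * δ)) (fun x _ => beta_nonneg R hδ x) (sum_beta R hδ)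
    (fun _ _ => Set.mem_univ _)
  simp only [smul_eq_mul] at hJ
  have h1 : ∑ x, beta R δ x * Real.exp (bohrNorm R x / (2 * δ)) ≤ 5 ^ R.card := by
    have h2 : ∀ x, beta R δ x * Real.exp (bohrNorm R x / (2 * δ)) =
        Real.exp (-(bohrNorm R x / 2) / δ) / ∑ y, Real.exp (-bohrNorm R y / δ) := by
      intro x
      rw [beta_eq R hδ, div_mul_eq_mul_div, ← Real.exp_add]
      congr 2
      field_simp
      ring
    simp_rw [h2]
    rw [← Finset.sum_div, div_le_iff₀ hS]
    exact sum_exp_half_bohrNorm_le R hδ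
  have h3 : (5 : ℝ) ^ R.card ≤ Real.exp (2 * R.card) := by
    rw [mul_comm, Real.exp_nat_mul]
    refine pow_le_pow_left₀ (by norm_num) ?_ _
    have h4 := Real.exp_one_gt_d9
    have h5 : Real.exp 2 = Real.exp 1 * Real.exp 1 := by
      rw [← Real.exp_add]
      norm_num
    nlinarith
  have h6 := Real.exp_le_exp.1 (hJ.trans (h1.trans h3))
  simp_rw [← mul_div_assoc] at h6
  rw [← Finset.sum_div, div_le_iff₀ (by positivity)] at h6
  linarith

/-! ### The smoothed cutoff -/

lemma psi_nonneg (R : Finset (AddChar G ℂ)) {δ : ℝ} (hδ : 0 < δ) (x : G) : 0 ≤ psi R δ x :=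
  Finset.sum_nonneg fun _ _ => mul_nonneg (beta_nonneg R hδ _) (beta_nonneg R hδ _)

lemma sum_psi (R : Finset (AddChar G ℂ)) {δ : ℝ} (hδ : 0 < δ) : ∑ x, psi R δ x = 1 := by
  simp only [psi, conv]
  rw [Finset.sum_comm]
  simp_rw [← Finset.mul_sum, sum_sub_right_eq (beta R δ), sum_beta R hδ, mul_one]
  exact sum_beta R hδ

lemma psi_neg (R : Finset (AddChar G ℂ)) {δ : ℝ} (hδ : 0 < δ) (x : G) :
    psi R δ (-x) = psi R δ x := by
  simp only [psi, conv]
  rw [← Equiv.sum_comp (Equiv.neg G)]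
  refine Finset.sum_congr rfl fun y _ => ?_
  rw [Equiv.neg_apply, beta_neg R hδ, ← beta_neg R hδ (x - y)]
  congr 2
  abel

lemma sum_abs_psi_add_sub_le (R : Finset (AddChar G ℂ)) {δ : ℝ} (hδ : 0 < δ) (y : G) :
    ∑ x, |psi R δ (x + y) - psi R δ x| ≤ 2 * bohrNorm R y / δ := by
  calc ∑ x, |psi R δ (x + y) - psi R δ x|
      ≤ ∑ x, ∑ z, beta R δ z * |beta R δ (x - z + y) - beta R δ (x - z)| := by
        refine Finset.sum_le_sum fun x _ => ?_
        simp only [psi, conv]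
        rw [← Finset.sum_sub_distrib]
        refine (Finset.abs_sum_le_sum_abs _ _).trans_eq (Finset.sum_congr rfl fun z _ => ?_)
        rw [← mul_sub, abs_mul, abs_of_nonneg (beta_nonneg R hδ z), add_sub_right_comm]
    _ = ∑ x, |beta R δ (x + y) - beta R δ x| := by
        rw [Finset.sum_comm]
        simp_rw [← Finset.mul_sum]
        simp_rw [sum_sub_right_eq (fun x => |beta R δ (x + y) - beta R δ x|)]
        rw [← Finset.sum_mul, sum_beta R hδ, one_mul]
    _ ≤ _ := sum_abs_beta_add_sub_le R hδ y

lemma sum_psi_mul_bohrNorm_le (R : Finset (AddChar G ℂ)) {δ : ℝ} (hδ : 0 < δ) :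
    ∑ x, psi R δ x * bohrNorm R x ≤ 8 * δ * R.card := by
  calc ∑ x, psi R δ x * bohrNorm R x
      = ∑ y, ∑ x, beta R δ y * beta R δ x * bohrNorm R (x + y) := by
        simp only [psi, conv, Finset.sum_mul]
        rw [Finset.sum_comm]
        refine Finset.sum_congr rfl fun y _ => ?_
        rw [← sum_add_right_eq _ y]
        simp
    _ ≤ ∑ y, ∑ x, beta R δ y * beta R δ x * (bohrNorm R x + bohrNorm R y) :=
        Finset.sum_le_sum fun y _ => Finset.sum_le_sum fun x _ =>
          mul_le_mul_of_nonneg_left (bohrNorm_add_le R x y)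
            (mul_nonneg (beta_nonneg R hδ y) (beta_nonneg R hδ x))
    _ = 2 * ∑ x, beta R δ x * bohrNorm R x := by
        have h : ∀ y, ∑ x, beta R δ y * beta R δ x * (bohrNorm R x + bohrNorm R y) =
            beta R δ y * (∑ x, beta R δ x * bohrNorm R x) +
              beta R δ y * bohrNorm R y * ∑ x, beta R δ x := by
          intro y
          rw [Finset.mul_sum, Finset.mul_sum, ← Finset.sum_add_distrib]
          exact Finset.sum_congr rfl fun x _ => by ring
        simp_rw [h, sum_beta R hδ]
        rw [Finset.sum_add_distrib, ← Finset.sum_mul, sum_beta R hδ]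
        simp only [mul_one]
        ring
    _ ≤ _ := by linarith [sum_beta_mul_bohrNorm_le R hδ]

/-! ### Averaging against even probability weights -/

/-- An even probability weight on `G`. -/
structure IsEvenWeight (φ : G → ℝ) : Prop where
  nonneg : ∀ x, 0 ≤ φ x
  sum_eq_one : ∑ x, φ x = 1
  even : ∀ x, φ (-x) = φ x

lemma isEvenWeight_psi (R : Finset (AddChar G ℂ)) {δ : ℝ} (hδ : 0 < δ) :
    IsEvenWeight (psi R δ) :=
  ⟨psi_nonneg R hδ, sum_psi R hδ, psi_neg R hδ⟩

/-- The `ℓ¹` modulus of continuity of `Φ`, averaged over translations drawn from `φ`. -/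
noncomputable def shiftError {E : Type*} [NormedAddCommGroup E] (Φ : G → E) (φ : G → ℝ) : ℝ :=
  ∑ y, φ y * ∑ x, ‖Φ (x + y) - Φ x‖

/-- The energy `‖f ∗ φ‖₂²`. -/
noncomputable def energy (f φ : G → ℝ) : ℝ := ∑ x, conv f φ x ^ 2

lemma conv_eq_sum_sub (f φ : G → ℝ) (x : G) : conv f φ x = ∑ y, φ y * f (x - y) := by
  rw [conv, ← sum_sub_left_eq _ x]
  simp [mul_comm]

lemma conv_eq_sum_add (f : G → ℝ) {φ : G → ℝ} (hφ : IsEvenWeight φ) (x : G) :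
    conv f φ x = ∑ n, f (x + n) * φ n := by
  rw [conv_eq_sum_sub, ← Equiv.sum_comp (Equiv.neg G)]
  simp [hφ.even, mul_comm]

lemma conv_nonneg {f φ : G → ℝ} (hf : ∀ x, f x ∈ Set.Icc (0 : ℝ) 1) (hφ : IsEvenWeight φ)
    (x : G) : 0 ≤ conv f φ x :=
  Finset.sum_nonneg fun _ _ => mul_nonneg (hf _).1 (hφ.nonneg _)

lemma conv_le_one {f φ : G → ℝ} (hf : ∀ x, f x ∈ Set.Icc (0 : ℝ) 1) (hφ : IsEvenWeight φ)
    (x : G) : conv f φ x ≤ 1 := by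
  rw [conv_eq_sum_add f hφ, ← hφ.sum_eq_one]
  exact Finset.sum_le_sum fun n _ => mul_le_of_le_one_left (hφ.nonneg n) (hf _).2

lemma conv_sub_const (f : G → ℝ) {φ : G → ℝ} (hφ : IsEvenWeight φ) (c : ℝ) (x : G) :
    conv (fun z => f z - c) φ x = conv f φ x - c := by
  rw [conv_eq_sum_sub, conv_eq_sum_sub]
  simp_rw [mul_sub]
  rw [Finset.sum_sub_distrib, ← Finset.sum_mul, hφ.sum_eq_one, one_mul]

/-- Replacing `f` by `f ∗ φ` hardly changes its pairing with a function `Φ` that is almost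
invariant under translations drawn from `φ`. -/
lemma norm_sum_conv_smul_sub_le {E : Type*} [NormedAddCommGroup E] [NormedSpace ℝ E]
    {f φ : G → ℝ} (hf : ∀ x, |f x| ≤ 1) (hφ : IsEvenWeight φ) (Φ : G → E) (x : G) :
    ‖∑ n, conv f φ (x + n) • Φ n - ∑ n, f (x + n) • Φ n‖ ≤ shiftError Φ φ := by
  have h1 : ∑ n, conv f φ (x + n) • Φ n = ∑ y, φ y • ∑ n, f (x + n) • Φ (n + y) := by
    simp_rw [conv_eq_sum_sub, Finset.sum_smul, Finset.smul_sum, smul_smul]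
    rw [Finset.sum_comm]
    refine Finset.sum_congr rfl fun y _ => ?_
    rw [← sum_add_right_eq _ y]
    refine Finset.sum_congr rfl fun n _ => ?_
    rw [← add_assoc, add_sub_cancel_right]
  have h2 : ∑ n, f (x + n) • Φ n = ∑ y, φ y • ∑ n, f (x + n) • Φ n := by
    rw [← Finset.sum_smul, hφ.sum_eq_one, one_smul]
  rw [h1, h2, ← Finset.sum_sub_distrib]
  refine norm_sum_le_of_le _ fun y _ => ?_
  rw [← smul_sub, norm_smul, Real.norm_of_nonneg (hφ.nonneg y), ← Finset.sum_sub_distrib]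
  refine mul_le_mul_of_nonneg_left (norm_sum_le_of_le _ fun n _ => ?_) (hφ.nonneg y)
  rw [← smul_sub, norm_smul]
  exact mul_le_of_le_one_left (norm_nonneg _) (hf _)

/-- Almost orthogonality: if `φ'` lives at a much finer scale than `φ`, the local variance of
`f ∗ φ'` around `f ∗ φ` is at most the gain of energy in passing from `φ` to `φ'`. -/
lemma sum_variance_le {f φ φ' : G → ℝ} (hf : ∀ x, f x ∈ Set.Icc (0 : ℝ) 1)
    (hφ : IsEvenWeight φ) (hφ' : IsEvenWeight φ') {κ : ℝ} (hκ : shiftError φ φ' ≤ κ) :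
    ∑ x, ∑ y, (conv f φ' (x + y) - conv f φ x) ^ 2 * φ y ≤
      energy f φ' - energy f φ + 2 * κ * Fintype.card G := by
  have h1 : ∀ x, ∑ y, (conv f φ' (x + y) - conv f φ x) ^ 2 * φ y ≤
      ∑ y, conv f φ' (x + y) ^ 2 * φ y - conv f φ x ^ 2 + 2 * κ := by
    intro x
    have h2 : ∑ y, (conv f φ' (x + y) - conv f φ x) ^ 2 * φ y =
        ∑ y, conv f φ' (x + y) ^ 2 * φ y
          - 2 * conv f φ x * ∑ y, conv f φ' (x + y) • φ y + conv f φ x ^ 2 * ∑ y, φ y := by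
      rw [Finset.mul_sum, Finset.mul_sum, ← Finset.sum_sub_distrib, ← Finset.sum_add_distrib]
      refine Finset.sum_congr rfl fun y _ => ?_
      rw [smul_eq_mul]
      ring
    have h3 := (norm_sum_conv_smul_sub_le (fun z => abs_le.2 ⟨by linarith [(hf z).1], (hf z).2⟩)
      hφ' φ x).trans hκ
    simp only [smul_eq_mul] at h2 h3
    rw [← conv_eq_sum_add f hφ, Real.norm_eq_abs] at h3
    have h4 := (abs_le.1 h3).1
    have h5 := conv_nonneg hf hφ x
    have h6 := conv_le_one hf hφ x
    have h7 : 0 ≤ κ := (abs_nonneg _).trans h3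
    rw [h2, hφ.sum_eq_one]
    nlinarith [mul_nonneg h5 h7, mul_nonneg h5 (sub_nonneg.2 h4),
      mul_nonneg h7 (sub_nonneg.2 h6)]
  refine (Finset.sum_le_sum fun x _ => h1 x).trans_eq ?_
  rw [Finset.sum_add_distrib, Finset.sum_sub_distrib, Finset.sum_comm]
  simp_rw [← Finset.sum_mul, sum_add_right_eq (fun x => conv f φ' x ^ 2)]
  rw [← Finset.mul_sum, hφ.sum_eq_one]
  simp [energy]
  ring

lemma energy_sub_le {f φ φ' : G → ℝ} (hf : ∀ x, f x ∈ Set.Icc (0 : ℝ) 1)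
    (hφ : IsEvenWeight φ) (hφ' : IsEvenWeight φ') {κ : ℝ} (hκ : shiftError φ φ' ≤ κ) :
    energy f φ - 2 * κ * Fintype.card G ≤ energy f φ' := by
  have h := sum_variance_le hf hφ hφ' hκ
  have h2 : 0 ≤ ∑ x, ∑ y, (conv f φ' (x + y) - conv f φ x) ^ 2 * φ y :=
    Finset.sum_nonneg fun x _ => Finset.sum_nonneg fun y _ =>
      mul_nonneg (sq_nonneg _) (hφ.nonneg y)
  linarith

lemma energy_le_card {f φ : G → ℝ} (hf : ∀ x, f x ∈ Set.Icc (0 : ℝ) 1)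
    (hφ : IsEvenWeight φ) : energy f φ ≤ Fintype.card G := by
  have h : ∀ x ∈ Finset.univ, conv f φ x ^ 2 ≤ 1 := fun x _ =>
    pow_le_one₀ (conv_nonneg hf hφ x) (conv_le_one hf hφ x)
  simpa [energy] using Finset.sum_le_sum h

/-- Markov's inequality: a large local variance on a large set forces a gain of energy. -/
lemma mul_card_le_energy_sub {f φ φ' : G → ℝ} (hf : ∀ x, f x ∈ Set.Icc (0 : ℝ) 1)
    (hφ : IsEvenWeight φ) (hφ' : IsEvenWeight φ') {κ c : ℝ} (hκ : shiftError φ φ' ≤ κ)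
    (X : Finset G) (hX : ∀ x ∈ X, c ≤ ∑ y, (conv f φ' (x + y) - conv f φ x) ^ 2 * φ y) :
    c * X.card ≤ energy f φ' - energy f φ + 2 * κ * Fintype.card G := by
  refine le_trans ?_ (sum_variance_le hf hφ hφ' hκ)
  calc c * X.card = ∑ _x ∈ X, c := by rw [Finset.sum_const, nsmul_eq_mul, mul_comm]
    _ ≤ ∑ x ∈ X, ∑ y, (conv f φ' (x + y) - conv f φ x) ^ 2 * φ y := Finset.sum_le_sum hX
    _ ≤ _ := Finset.sum_le_sum_of_subset_of_nonneg (Finset.subset_univ _) fun x _ _ =>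
      Finset.sum_nonneg fun y _ => mul_nonneg (sq_nonneg _) (hφ.nonneg y)

/-! ### Local Fourier coefficients -/

/-- The Fourier coefficient at `γ` of the balanced localisation `(f⁺ˣ - (f ∗ φ)(x)) φ`. -/
noncomputable def localFourier (f φ : G → ℝ) (x : G) (γ : AddChar G ℂ) : ℂ :=
  fourier (fun n => (f (x + n) - conv f φ x) * φ n) γ

lemma norm_localFourier_le_add {f φ : G → ℝ} (hf : ∀ x, f x ∈ Set.Icc (0 : ℝ) 1)
    (hφ : IsEvenWeight φ) (x u : G) (γ : AddChar G ℂ) :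
    ‖localFourier f φ (x - u) γ‖ ≤
      ‖localFourier f φ x γ‖ + 2 * ∑ n, |φ (n + u) - φ n| := by
  have hα : |conv f φ x - conv f φ (x - u)| ≤ ∑ n, |φ (n + u) - φ n| := by
    have h1 : conv f φ (x - u) = ∑ n, f (x + n) * φ (n + u) := by
      rw [conv_eq_sum_add f hφ, ← sum_add_right_eq _ u]
      refine Finset.sum_congr rfl fun n _ => ?_
      congr 2
      abel
    rw [h1, conv_eq_sum_add f hφ, abs_sub_comm, ← Finset.sum_sub_distrib]
    refine (Finset.abs_sum_le_sum_abs _ _).trans (Finset.sum_le_sum fun n _ => ?_)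
    rw [← mul_sub, abs_mul, abs_of_nonneg (hf _).1]
    exact mul_le_of_le_one_left (abs_nonneg _) (hf _).2
  have h2 : localFourier f φ (x - u) γ =
      γ u * ∑ n, ((f (x + n) - conv f φ (x - u)) * φ (n + u) : ℝ) * γ n := by
    rw [localFourier, fourier, ← sum_add_right_eq _ u, Finset.mul_sum]
    refine Finset.sum_congr rfl fun n _ => ?_
    rw [AddChar.map_add_eq_mul, show x - u + (n + u) = x + n by abel]
    ring
  have h3 : ‖∑ n, ((f (x + n) - conv f φ (x - u)) * φ (n + u) : ℝ) * γ n -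
      localFourier f φ x γ‖ ≤ 2 * ∑ n, |φ (n + u) - φ n| := by
    rw [localFourier, fourier, ← Finset.sum_sub_distrib]
    have h4 : 2 * ∑ n, |φ (n + u) - φ n| =
        ∑ n, (|φ (n + u) - φ n| + (∑ m, |φ (m + u) - φ m|) * φ n) := by
      rw [Finset.sum_add_distrib, ← Finset.mul_sum, hφ.sum_eq_one]
      ring
    rw [h4]
    refine norm_sum_le_of_le _ fun n _ => ?_
    rw [← sub_mul, norm_mul, AddChar.norm_apply, mul_one, ← Complex.ofReal_sub,
      Complex.norm_real, Real.norm_eq_abs]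
    have h5 : (f (x + n) - conv f φ (x - u)) * φ (n + u) - (f (x + n) - conv f φ x) * φ n =
        (f (x + n) - conv f φ (x - u)) * (φ (n + u) - φ n) +
          (conv f φ x - conv f φ (x - u)) * φ n := by ring
    rw [h5]
    refine (abs_add_le _ _).trans (add_le_add ?_ ?_)
    · rw [abs_mul]
      refine mul_le_of_le_one_left (abs_nonneg _) (abs_le.2 ⟨?_, ?_⟩)
      · linarith [(hf (x + n)).1, conv_le_one hf hφ (x - u)]
      · linarith [(hf (x + n)).2, conv_nonneg hf hφ (x - u)]
    · rw [abs_mul, abs_of_nonneg (hφ.nonneg n)]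
      exact mul_le_mul_of_nonneg_right hα (hφ.nonneg n)
  rw [h2, norm_mul, AddChar.norm_apply, one_mul]
  have h6 := norm_sub_norm_le
    (∑ n, ((f (x + n) - conv f φ (x - u)) * φ (n + u) : ℝ) * γ n) (localFourier f φ x γ)
  linarith

lemma norm_sum_mul_char_sq_le {φ : G → ℝ} (hφ : IsEvenWeight φ) (g : G → ℝ)
    (γ : AddChar G ℂ) : ‖∑ n, g n • ((φ n : ℂ) * γ n)‖ ^ 2 ≤ ∑ n, g n ^ 2 * φ n := by
  have h1 : ‖∑ n, g n • ((φ n : ℂ) * γ n)‖ ≤ ∑ n, |g n| * φ n := by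
    refine norm_sum_le_of_le _ fun n _ => ?_
    rw [norm_smul, norm_mul, AddChar.norm_apply, mul_one, Complex.norm_real,
      Real.norm_of_nonneg (hφ.nonneg n), Real.norm_eq_abs]
  refine (pow_le_pow_left₀ (norm_nonneg _) h1 2).trans ?_
  have h2 := Finset.sum_sq_le_sum_mul_sum_of_sq_le_mul Finset.univ (r := fun n => |g n| * φ n)
    (f := φ) (g := fun n => g n ^ 2 * φ n) (fun n _ => hφ.nonneg n)
    (fun n _ => mul_nonneg (sq_nonneg _) (hφ.nonneg n))
    (fun n _ => by rw [mul_pow, sq_abs]; exact (by ring : _ = _).le)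
  rwa [hφ.sum_eq_one, one_mul] at h2

/-- A large local Fourier coefficient at `γ` forces a large local variance of `f ∗ φ'`, for every
weight `φ'` that hardly moves `φ · γ`. -/
lemma norm_localFourier_sub_sq_le {f φ φ' : G → ℝ} (hf : ∀ x, f x ∈ Set.Icc (0 : ℝ) 1)
    (hφ : IsEvenWeight φ) (hφ' : IsEvenWeight φ') (x : G) (γ : AddChar G ℂ) {c : ℝ}
    (hc : 0 ≤ c)
    (h : c + shiftError (fun n => (φ n : ℂ) * γ n) φ' ≤ ‖localFourier f φ x γ‖) :
    c ^ 2 ≤ ∑ n, (conv f φ' (x + n) - conv f φ x) ^ 2 * φ n := by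
  have h1 := norm_sum_conv_smul_sub_le (f := fun z => f z - conv f φ x) (φ := φ')
    (fun z => abs_le.2 ⟨by linarith [(hf z).1, conv_le_one hf hφ x],
      by linarith [(hf z).2, conv_nonneg hf hφ x]⟩) hφ' (fun n => (φ n : ℂ) * γ n) x
  simp_rw [conv_sub_const f hφ'] at h1
  have h2 : ∑ n, (f (x + n) - conv f φ x) • ((φ n : ℂ) * γ n) = localFourier f φ x γ := by
    rw [localFourier, fourier]
    refine Finset.sum_congr rfl fun n _ => ?_
    rw [Complex.real_smul]
    push_cast
    ring
  rw [h2, norm_sub_rev] at h1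
  refine le_trans (pow_le_pow_left₀ hc ?_ 2) (norm_sum_mul_char_sq_le hφ _ γ)
  have h3 := norm_sub_norm_le (localFourier f φ x γ)
    (∑ n, (conv f φ' (x + n) - conv f φ x) • ((φ n : ℂ) * γ n))
  linarith

lemma shiftError_mul_char_le {φ φ' : G → ℝ} (hφ : IsEvenWeight φ) (hφ' : IsEvenWeight φ')
    (γ : AddChar G ℂ) :
    shiftError (fun n => (φ n : ℂ) * γ n) φ' ≤ shiftError φ φ' + ∑ y, φ' y * ‖γ y - 1‖ := by
  rw [shiftError, shiftError, ← Finset.sum_add_distrib]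
  refine Finset.sum_le_sum fun y _ => ?_
  rw [← mul_add]
  refine mul_le_mul_of_nonneg_left ?_ (hφ'.nonneg y)
  have h1 : ‖γ y - 1‖ = ∑ n, φ n * ‖γ y - 1‖ := by
    rw [← Finset.sum_mul, hφ.sum_eq_one, one_mul]
  rw [h1, ← Finset.sum_add_distrib]
  refine Finset.sum_le_sum fun n _ => ?_
  have h2 : (φ (n + y) : ℂ) * γ (n + y) - φ n * γ n =
      ((φ (n + y) - φ n : ℝ) : ℂ) * (γ n * γ y) + φ n * (γ n * (γ y - 1)) := by
    rw [AddChar.map_add_eq_mul]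
    push_cast
    ring
  rw [h2]
  refine (norm_add_le _ _).trans_eq ?_
  simp only [norm_mul, AddChar.norm_apply, Complex.norm_real, mul_one, one_mul,
    Real.norm_of_nonneg (hφ.nonneg n)]

end AbelianRegularity

namespace AbelianRegularity

variable {G : Type*} [AddCommGroup G]

/-! ### The second width -/

section Widths

variable {k : ℕ} {ε η : ℝ} {R : Finset (AddChar G ℂ)}

lemma eta2_pos (hk : 1 ≤ k) (hε : 0 < ε) (hR : R.Nonempty) (hη : 0 < η) :
    0 < eta2 k ε R η := by
  have h1 : (0 : ℝ) < R.card := by exact_mod_cast hR.card_pos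
  have h2 : (0 : ℝ) < k := by exact_mod_cast hk
  unfold eta2
  positivity

/-- The width `η₂` is small enough for the translations drawn from `ψ₂` to have a mean Bohr
seminorm that is tiny compared with `η`. -/
lemma eta2_mul_card_le (hk : 1 ≤ k) (hε : 0 < ε) (hε1 : ε ≤ 1) (hR : R.Nonempty) (hη : 0 < η) :
    8 * eta2 k ε R η * R.card ≤ 2 ^ (-37 : ℤ) * (ε ^ 3 / k) * η := by
  have h1 : (0 : ℝ) < R.card := by exact_mod_cast hR.card_pos
  have h2 : (1 : ℝ) ≤ k := by exact_mod_cast hk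
  have h3 : 8 * eta2 k ε R η * R.card = 2 ^ (-37 : ℤ) * (ε ^ 6 / k ^ 4) * η := by
    unfold eta2
    rw [zpow_neg, zpow_neg]
    field_simp
    norm_num
  rw [h3]
  refine mul_le_mul_of_nonneg_right (mul_le_mul_of_nonneg_left ?_ (by positivity)) hη.le
  refine div_le_div₀ (by positivity) ?_ (by positivity) ?_
  · exact pow_le_pow_of_le_one hε.le hε1 (by norm_num)
  · exact le_self_pow₀ h2 (by norm_num)

lemma eta2_le (hk : 1 ≤ k) (hε : 0 < ε) (hε1 : ε ≤ 1) (hR : R.Nonempty) (hη : 0 < η) :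
    eta2 k ε R η ≤ η := by
  have h1 : (1 : ℝ) ≤ R.card := by exact_mod_cast hR.card_pos
  have h2 : (1 : ℝ) ≤ k := by exact_mod_cast hk
  have h3 := eta2_mul_card_le hk hε hε1 hR hη
  have h4 := eta2_pos hk hε hR hη
  have h5 : ε ^ 3 / k ≤ 1 := by
    rw [div_le_one (by linarith)]
    exact (pow_le_one₀ hε.le hε1).trans h2
  have h6 : (2 : ℝ) ^ (-37 : ℤ) * (ε ^ 3 / k) * η ≤ 1 * 1 * η := by
    gcongr
    norm_num
  nlinarith

end Widths

variable [Fintype G]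

/-! ### The energy increment -/

lemma ind_mem_Icc {X : Type*} (A : Set X) (x : X) : ind A x ∈ Set.Icc (0 : ℝ) 1 := by
  by_cases h : x ∈ A <;> simp [ind, h]

lemma shiftError_psi_le {R S : Finset (AddChar G ℂ)} (hRS : R ⊆ S) {δ δ' : ℝ} (hδ : 0 < δ)
    (hδ' : 0 < δ') :
    shiftError (psi R δ) (psi S δ') ≤ 2 * (8 * δ' * S.card) / δ := by
  calc shiftError (psi R δ) (psi S δ')
      ≤ ∑ y, psi S δ' y * (2 * bohrNorm S y / δ) := by
        refine Finset.sum_le_sum fun y _ =>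
          mul_le_mul_of_nonneg_left ?_ (psi_nonneg S hδ' y)
        refine (sum_abs_psi_add_sub_le R hδ y).trans ?_
        exact div_le_div_of_nonneg_right (by linarith [bohrNorm_mono hRS y]) hδ.le
    _ = 2 * (∑ y, psi S δ' y * bohrNorm S y) / δ := by
        rw [Finset.mul_sum, Finset.sum_div]
        exact Finset.sum_congr rfl fun y _ => by ring
    _ ≤ _ := by
        refine div_le_div_of_nonneg_right ?_ hδ.le
        linarith [sum_psi_mul_bohrNorm_le S hδ']

lemma sum_psi_mul_norm_sub_one_le {S : Finset (AddChar G ℂ)} {γ : AddChar G ℂ} (hγ : γ ∈ S)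
    {δ : ℝ} (hδ : 0 < δ) :
    ∑ y, psi S δ y * ‖γ y - 1‖ ≤ 2 * Real.pi * (8 * δ * S.card) := by
  calc ∑ y, psi S δ y * ‖γ y - 1‖
      ≤ ∑ y, 2 * Real.pi * (psi S δ y * bohrNorm S y) := by
        refine Finset.sum_le_sum fun y _ => ?_
        rw [mul_left_comm]
        exact mul_le_mul_of_nonneg_left (norm_sub_one_le_bohrNorm hγ y) (psi_nonneg S hδ y)
    _ ≤ _ := by
        rw [← Finset.mul_sum]
        exact mul_le_mul_of_nonneg_left (sum_psi_mul_bohrNorm_le S hδ) Real.two_pi_pos.le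

lemma shiftError_psi_eta2_le {k : ℕ} {ε η : ℝ} (hk : 1 ≤ k) (hε : 0 < ε) (hε1 : ε ≤ 1)
    {R S : Finset (AddChar G ℂ)}
    (hRS : R ⊆ S) (hS : S.Nonempty) (hη : 0 < η) :
    shiftError (psi R η) (psi S (eta2 k ε S η)) ≤ 2 ^ (-36 : ℤ) * (ε ^ 3 / k) := by
  refine (shiftError_psi_le hRS hη (eta2_pos hk hε hS hη)).trans ?_
  rw [div_le_iff₀ hη]
  have := eta2_mul_card_le hk hε hε1 hS hη
  norm_num at this ⊢
  linarith

lemma not_isRegularValue_iff {k : ℕ} {ε : ℝ} {R : Finset (AddChar G ℂ)} {η : ℝ} {A : Set G}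
    {x : G} : ¬ IsRegularValue k ε R η A x ↔
      ε ^ 2 < ∑ y, (conv (ind A) (psi R (eta2 k ε R η)) (x + y) -
        conv (ind A) (psi R η) x) ^ 2 * psi R η y ∨
      ∃ γ, ε < ‖localFourier (ind A) (psi R (eta2 k ε R η)) x γ‖ := by
  constructor
  · intro h
    by_contra! h'
    exact h ⟨h'.1, h'.2⟩
  · rintro (h | ⟨γ, h⟩) ⟨h1, h2⟩
    · exact h.not_ge h1
    · exact h.not_ge (h2 γ)

/-- If `(R, η)` is not regular for `A`, finitely many characters can be added to `R`, one for each
point of a Bohr net in the set of points with a large local Fourier coefficient, so that the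
energy of `A` increases. -/
lemma exists_energy_increment {k : ℕ} (hk : 1 ≤ k) {ε : ℝ} (hε : 0 < ε) (hε1 : ε ≤ 1)
    {R : Finset (AddChar G ℂ)} (hR : R.Nonempty) {η : ℝ} (hη : 0 < η) (hη1 : η ≤ 1)
    {A : Set G} (hA : ¬ IsRegularPair k ε R η A) :
    ∃ S, R ⊆ S ∧ (S.card : ℝ) ≤ R.card + (32 / (ε * eta2 k ε R η) + 3) ^ R.card ∧
      energy (ind A) (psi R η) + (1 / 8 - 2 ^ (-34 : ℤ)) * ε ^ 3 * Fintype.card G ≤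
        energy (ind A) (psi S (eta2 k ε S (eta2 k ε R η))) := by
  classical
  set η₂ := eta2 k ε R η with hη₂
  have hη₂0 : 0 < η₂ := eta2_pos hk hε hR hη
  have hη₂1 : η₂ ≤ 1 := (eta2_le hk hε hε1 hR hη).trans hη1
  have hf := ind_mem_Icc A
  have hφ₁ := isEvenWeight_psi R hη
  have hφ₂ := isEvenWeight_psi R hη₂0
  have hk1 : (1 : ℝ) ≤ k := by exact_mod_cast hk
  have hεk : ε ^ 3 / k ≤ ε ^ 3 := div_le_self (by positivity) hk1
  have hN : (0 : ℝ) < Fintype.card G := by exact_mod_cast Fintype.card_pos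
  set X := Finset.univ.filter fun x => ε ^ 2 < ∑ y, (conv (ind A) (psi R η₂) (x + y) -
    conv (ind A) (psi R η) x) ^ 2 * psi R η y with hX
  set Y := Finset.univ.filter fun x => ∃ γ, ε < ‖localFourier (ind A) (psi R η₂) x γ‖ with hY
  have ht : 0 < ε * η₂ / 32 := by positivity
  -- At distance `t = ε η₂ / 32` a local Fourier coefficient changes by at most `4 t / η₂ = ε / 8`.
  obtain ⟨T, hTY, hTcard, hTnet⟩ := exists_bohr_net R ht Y
  have hchar : ∀ x ∈ Y, ∃ γ, ε < ‖localFourier (ind A) (psi R η₂) x γ‖ := fun x hx =>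
    (Finset.mem_filter.1 hx).2
  choose! γ hγ using hchar
  set S := R ∪ T.image γ with hS
  have hRS : R ⊆ S := Finset.subset_union_left
  have hS0 : S.Nonempty := hR.mono hRS
  set η₃ := eta2 k ε S η₂
  have hη₃0 : 0 < η₃ := eta2_pos hk hε hS0 hη₂0
  have hφ₃ := isEvenWeight_psi S hη₃0
  have hκ₂ : shiftError (psi R η) (psi R η₂) ≤ 2 ^ (-36 : ℤ) * ε ^ 3 :=
    (shiftError_psi_eta2_le hk hε hε1 subset_rfl hR hη).trans (by gcongr)
  have hκ₃ : shiftError (psi R η₂) (psi S η₃) ≤ 2 ^ (-36 : ℤ) * ε ^ 3 :=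
    (shiftError_psi_eta2_le hk hε hε1 hRS hS0 hη₂0).trans (by gcongr)
  refine ⟨S, hRS, ?_, ?_⟩
  · have h1 : (S.card : ℝ) ≤ R.card + T.card := by
      exact_mod_cast (Finset.card_union_le _ _).trans
        (Nat.add_le_add_left Finset.card_image_le _)
    rw [one_div_div] at hTcard
    linarith
  have hE₂ := energy_sub_le hf hφ₁ hφ₂ hκ₂
  have hE₃ := energy_sub_le hf hφ₂ hφ₃ hκ₃
  have hXY : ε * Fintype.card G ≤ X.card + Y.card := by
    have h1 : {x : G | ¬ IsRegularValue k ε R η A x} = ((X ∪ Y : Finset G) : Set G) := by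
      ext x
      simp [hX, hY, not_isRegularValue_iff, ← hη₂]
    rw [IsRegularPair, h1, Set.ncard_coe_finset, not_lt] at hA
    exact hA.trans (by exact_mod_cast Finset.card_union_le X Y)
  norm_num at hE₂ hE₃ hκ₂ hκ₃ ⊢
  have hεN : 0 < ε ^ 3 * Fintype.card G := by positivity
  rcases le_total (ε * Fintype.card G / 2) X.card with h | h
  · have h1 := mul_card_le_energy_sub hf hφ₁ hφ₂ hκ₂ X fun x hx =>
      (Finset.mem_filter.1 hx).2.le
    have h2 : ε ^ 3 * Fintype.card G / 2 ≤ ε ^ 2 * X.card := by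
      have := mul_le_mul_of_nonneg_left h (sq_nonneg ε)
      linarith
    linarith
  · have h1 := mul_card_le_energy_sub (c := (ε / 2) ^ 2) hf hφ₂ hφ₃ hκ₃ Y fun x hx => by
      obtain ⟨y, hyT, hxy⟩ := hTnet x hx
      have hyS : γ y ∈ S := Finset.mem_union_right _ (Finset.mem_image_of_mem _ hyT)
      refine norm_localFourier_sub_sq_le hf hφ₂ hφ₃ x (γ y) (by positivity) ?_
      have h2 := norm_localFourier_le_add hf hφ₂ x (x - y) (γ y)
      rw [sub_sub_cancel] at h2
      have h3 := hγ y (hTY hyT)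
      have h4 : ∑ n, |psi R η₂ (n + (x - y)) - psi R η₂ n| ≤ ε / 16 := by
        refine (sum_abs_psi_add_sub_le R hη₂0 _).trans ?_
        rw [div_le_iff₀ hη₂0]
        linarith
      have h5 := shiftError_mul_char_le hφ₂ hφ₃ (γ y)
      have h6 := sum_psi_mul_norm_sub_one_le hyS hη₃0
      have h7 : 8 * η₃ * S.card ≤ ε / 64 := by
        have h8 := eta2_mul_card_le hk hε hε1 hS0 hη₂0
        have h9 : ε ^ 3 ≤ ε := pow_le_of_le_one hε.le hε1 (by norm_num)
        have h10 : (2 : ℝ) ^ (-37 : ℤ) * (ε ^ 3 / k) * η₂ ≤ 2 ^ (-37 : ℤ) * ε * 1 := by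
          gcongr
          exact hεk.trans h9
        norm_num at h8 h10
        linarith
      have h11 : 2 * Real.pi * (8 * η₃ * S.card) ≤ 8 * (ε / 64) :=
        mul_le_mul (by linarith [Real.pi_lt_four]) h7 (by positivity) (by norm_num)
      have h12 : ε ^ 3 ≤ ε := pow_le_of_le_one hε.le hε1 (by norm_num)
      linarith
    have h2 : ε ^ 3 * Fintype.card G / 8 ≤ (ε / 2) ^ 2 * Y.card := by
      have h3 : ε * Fintype.card G / 2 ≤ Y.card := by linarith
      have := mul_le_mul_of_nonneg_left h3 (sq_nonneg (ε / 2))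
      linarith
    linarith

/-- The total energy of the sets `A i` at the pair `(R, η)`. -/
noncomputable def totalEnergy {k : ℕ} (A : Fin k → Set G) (R : Finset (AddChar G ℂ)) (η : ℝ) :
    ℝ :=
  ∑ i, energy (ind (A i)) (psi R η)

lemma totalEnergy_le {k : ℕ} (A : Fin k → Set G) (R : Finset (AddChar G ℂ)) {η : ℝ}
    (hη : 0 < η) : totalEnergy A R η ≤ k * Fintype.card G := by
  simpa [totalEnergy] using Finset.sum_le_sum fun i (_ : i ∈ Finset.univ) =>
    energy_le_card (ind_mem_Icc (A i)) (isEvenWeight_psi R hη)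

lemma exists_totalEnergy_increment {k : ℕ} (hk : 1 ≤ k) {ε : ℝ} (hε : 0 < ε) (hε1 : ε ≤ 1)
    {R : Finset (AddChar G ℂ)} (hR : R.Nonempty) {η : ℝ} (hη : 0 < η) (hη1 : η ≤ 1)
    {A : Fin k → Set G} {i : Fin k} (hA : ¬ IsRegularPair k ε R η (A i)) :
    ∃ S, R ⊆ S ∧ (S.card : ℝ) ≤ R.card + (32 / (ε * eta2 k ε R η) + 3) ^ R.card ∧
      totalEnergy A R η + ε ^ 3 / 16 * Fintype.card G ≤
        totalEnergy A S (eta2 k ε S (eta2 k ε R η)) := by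
  classical
  obtain ⟨S, hRS, hcard, hinc⟩ := exists_energy_increment hk hε hε1 hR hη hη1 hA
  refine ⟨S, hRS, hcard, ?_⟩
  have hS0 : S.Nonempty := hR.mono hRS
  have hk1 : (0 : ℝ) < k := by exact_mod_cast hk
  have hη₂ := eta2_pos hk hε hR hη
  -- Each of the `k` sets loses at most `2 ^ (-34) * ε ^ 3 / k` of its normalised energy.
  have hloss : ∀ j, energy (ind (A j)) (psi R η) +
      ((if j = i then ε ^ 3 / 8 - 2 ^ (-34 : ℤ) * ε ^ 3 else 0) - 2 ^ (-34 : ℤ) * (ε ^ 3 / k)) *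
        Fintype.card G ≤
      energy (ind (A j)) (psi S (eta2 k ε S (eta2 k ε R η))) := by
    intro j
    have hN : (0 : ℝ) ≤ Fintype.card G := Nat.cast_nonneg _
    have hεk : 0 ≤ ε ^ 3 / k * Fintype.card G := by positivity
    split_ifs with hj
    · subst hj
      norm_num at hinc ⊢
      linarith
    · have h1 := energy_sub_le (ind_mem_Icc (A j)) (isEvenWeight_psi R hη)
        (isEvenWeight_psi R hη₂) (shiftError_psi_eta2_le hk hε hε1 subset_rfl hR hη)
      have h2 := energy_sub_le (ind_mem_Icc (A j)) (isEvenWeight_psi R hη₂)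
        (isEvenWeight_psi S (eta2_pos hk hε hS0 hη₂))
        (shiftError_psi_eta2_le hk hε hε1 hRS hS0 hη₂)
      norm_num at h1 h2 ⊢
      linarith
  refine le_trans ?_ (Finset.sum_le_sum fun j _ => hloss j)
  rw [Finset.sum_add_distrib, totalEnergy, ← Finset.sum_mul, Finset.sum_sub_distrib]
  simp only [Finset.sum_ite_eq', Finset.mem_univ, if_true, Finset.sum_const, Finset.card_univ,
    Fintype.card_fin, nsmul_eq_mul]
  have h1 : (k : ℝ) * (2 ^ (-34 : ℤ) * (ε ^ 3 / k)) = 2 ^ (-34 : ℤ) * ε ^ 3 := by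
    field_simp
  rw [h1]
  have h2 : 0 < ε ^ 3 * Fintype.card G := by positivity
  norm_num
  linarith

end AbelianRegularity

namespace AbelianRegularity

/-! ### Towers -/

lemma lt_tower : ∀ n, n < tower n
  | 0 => Nat.one_pos
  | n + 1 => (Nat.succ_le_of_lt (lt_tower n)).trans_lt Nat.lt_two_pow_self

lemma tower_mono : Monotone tower :=
  monotone_nat_of_le_succ fun _ => Nat.lt_two_pow_self.le

lemma cube_le_two_pow {n : ℕ} (hn : 10 ≤ n) : n ^ 3 ≤ 2 ^ n := by
  induction n, hn using Nat.le_induction with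
  | base => norm_num
  | succ n hn ih =>
    rw [pow_succ 2]
    nlinarith [Nat.mul_le_mul hn hn, Nat.mul_le_mul (Nat.mul_le_mul hn hn) hn,
      Nat.mul_le_mul_right (n * n) hn, Nat.mul_le_mul_right n hn]

lemma pow_le_two_pow_two_pow {D : ℕ} (hD : 256 ≤ D) : D ^ (52 * D) ≤ 2 ^ 2 ^ D := by
  calc D ^ (52 * D) ≤ (2 ^ D) ^ (52 * D) := Nat.pow_le_pow_left Nat.lt_two_pow_self.le _
    _ = 2 ^ (D * (52 * D)) := (pow_mul ..).symm
    _ ≤ 2 ^ 2 ^ D := by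
      refine Nat.pow_le_pow_right two_pos (le_trans ?_ (cube_le_two_pow (by omega)))
      have : D * (52 * D) ≤ D * (D * D) :=
        Nat.mul_le_mul_left _ (Nat.mul_le_mul_right _ (by omega))
      linarith [this, (by ring : D ^ 3 = D * (D * D))]

/-! ### Growth of the parameters -/

variable {G : Type*} [AddCommGroup G]

section Growth

variable {k D : ℕ} {ε η : ℝ} {R : Finset (AddChar G ℂ)}

lemma inv_eta2_le (hk : 1 ≤ k) (hkD : k ≤ D) (hε : 0 < ε) (hεD : 1 / ε ≤ D)
    (hη : 0 < η) : 1 / eta2 k ε R η ≤ 2 ^ 40 * (D : ℝ) ^ 10 * R.card * (1 / η) := by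
  have h1 : (0 : ℝ) < k := by exact_mod_cast hk
  have h2 : (k : ℝ) ≤ D := by exact_mod_cast hkD
  have h3 : 1 / eta2 k ε R η = 2 ^ 40 * ((1 / ε) ^ 6 * k ^ 4) * R.card * (1 / η) := by
    unfold eta2
    rw [zpow_neg, one_div_div, one_div_pow]
    norm_num
    ring
  rw [h3]
  have h4 : (1 / ε) ^ 6 * (k : ℝ) ^ 4 ≤ (D : ℝ) ^ 10 := by
    calc (1 / ε) ^ 6 * (k : ℝ) ^ 4 ≤ (D : ℝ) ^ 6 * (D : ℝ) ^ 4 := by gcongr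
      _ = (D : ℝ) ^ 10 := by ring
  gcongr

/-- One step of the iteration costs two exponentials: the new frequency set and the new inverse
width are both at most `D ^ (52 * D)`. -/
lemma growth_le (hk : 1 ≤ k) (hkD : k ≤ D) (hε : 0 < ε) (hεD : 1 / ε ≤ D) (hD : 256 ≤ D)
    (hR : R.Nonempty) (hRD : R.card ≤ D) (hη : 0 < η) (hηD : 1 / η ≤ D)
    {S : Finset (AddChar G ℂ)} (hS : S.Nonempty)
    (hSR : (S.card : ℝ) ≤ R.card + (32 / (ε * eta2 k ε R η) + 3) ^ R.card) :
    (S.card : ℝ) ≤ 2 ^ 2 ^ D ∧ 1 / eta2 k ε S (eta2 k ε R η) ≤ 2 ^ 2 ^ D := by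
  have hD1 : (256 : ℝ) ≤ D := by exact_mod_cast hD
  have hD0 : (1 : ℝ) ≤ D := by linarith
  have hRD' : (R.card : ℝ) ≤ D := by exact_mod_cast hRD
  have hη₂ : 0 < eta2 k ε R η := eta2_pos hk hε hR hη
  have h40 : (2 : ℝ) ^ 40 ≤ (D : ℝ) ^ 5 := by
    calc (2 : ℝ) ^ 40 = 256 ^ 5 := by norm_num
      _ ≤ _ := by gcongr
  have h46 : (2 : ℝ) ^ 46 ≤ (D : ℝ) ^ 6 := by
    calc (2 : ℝ) ^ 46 ≤ 256 ^ 6 := by norm_num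
      _ ≤ _ := by gcongr
  have h1 : 1 / eta2 k ε R η ≤ 2 ^ 40 * (D : ℝ) ^ 12 := by
    calc 1 / eta2 k ε R η ≤ 2 ^ 40 * (D : ℝ) ^ 10 * R.card * (1 / η) :=
          inv_eta2_le hk hkD hε hεD hη
      _ ≤ 2 ^ 40 * (D : ℝ) ^ 10 * D * D := by gcongr
      _ = _ := by ring
  have h2 : 32 / (ε * eta2 k ε R η) + 3 ≤ (D : ℝ) ^ 19 := by
    have h3 : 32 / (ε * eta2 k ε R η) ≤ 2 ^ 45 * (D : ℝ) ^ 13 := by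
      calc 32 / (ε * eta2 k ε R η) = 32 * ((1 / ε) * (1 / eta2 k ε R η)) := by
            field_simp
        _ ≤ 32 * (D * (2 ^ 40 * (D : ℝ) ^ 12)) := by gcongr
        _ = _ := by ring
    have h4 : (1 : ℝ) ≤ (D : ℝ) ^ 13 := one_le_pow₀ hD0
    calc 32 / (ε * eta2 k ε R η) + 3 ≤ 2 ^ 46 * (D : ℝ) ^ 13 := by linarith
      _ ≤ (D : ℝ) ^ 6 * (D : ℝ) ^ 13 := by gcongr
      _ = (D : ℝ) ^ 19 := by ring
  have h5 : (S.card : ℝ) ≤ (D : ℝ) ^ (20 * D) := by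
    have h6 : (32 / (ε * eta2 k ε R η) + 3) ^ R.card ≤ (D : ℝ) ^ (19 * D) := by
      calc (32 / (ε * eta2 k ε R η) + 3) ^ R.card ≤ ((D : ℝ) ^ 19) ^ R.card := by gcongr
        _ ≤ ((D : ℝ) ^ 19) ^ D := pow_le_pow_right₀ (one_le_pow₀ hD0) hRD
        _ = _ := (pow_mul ..).symm
    have h7 : (D : ℝ) ≤ (D : ℝ) ^ (19 * D) := le_self_pow₀ hD0 (by omega)
    calc (S.card : ℝ) ≤ 2 * (D : ℝ) ^ (19 * D) := by linarith
      _ ≤ D * (D : ℝ) ^ (19 * D) := by gcongr; linarith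
      _ = (D : ℝ) ^ (19 * D + 1) := (pow_succ' ..).symm
      _ ≤ _ := pow_le_pow_right₀ hD0 (by omega)
  have h8 : (D : ℝ) ^ (52 * D) ≤ 2 ^ 2 ^ D := by exact_mod_cast pow_le_two_pow_two_pow hD
  refine ⟨h5.trans (le_trans (pow_le_pow_right₀ hD0 (by omega)) h8), le_trans ?_ h8⟩
  calc 1 / eta2 k ε S (eta2 k ε R η)
      ≤ 2 ^ 40 * (D : ℝ) ^ 10 * S.card * (1 / eta2 k ε R η) :=
        inv_eta2_le hk hkD hε hεD hη₂
    _ ≤ (D : ℝ) ^ 5 * (D : ℝ) ^ 10 * (D : ℝ) ^ (20 * D) * ((D : ℝ) ^ 5 * (D : ℝ) ^ 12) := by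
        gcongr
        exact h1.trans (by gcongr)
    _ = (D : ℝ) ^ (20 * D + 32) := by ring
    _ ≤ _ := pow_le_pow_right₀ hD0 (by omega)

end Growth

/-! ### Iteration -/

variable [Fintype G]

/-- After `m` steps of the iteration, either a regular pair has been found or the total energy has
grown by `m ε³ |G| / 16`, at the cost of a tower of height `2 m`. -/
lemma exists_regular_or_large_energy {k : ℕ} (hk : 1 ≤ k) {ε : ℝ} (hε : 0 < ε) (hε1 : ε ≤ 1)
    (A : Fin k → Set G) {h : ℕ} (hkh : k ≤ tower h) (hεh : 1 / ε ≤ tower h)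
    (hh : 256 ≤ tower h) (m : ℕ) :
    ∃ (R : Finset (AddChar G ℂ)) (η : ℝ), R.Nonempty ∧ 0 < η ∧ η < 1 ∧
      R.card ≤ tower (h + 2 * m) ∧ 1 / η ≤ tower (h + 2 * m) ∧
      ((∀ i, IsRegularPair k ε R η (A i)) ∨
        m * (ε ^ 3 / 16 * Fintype.card G) ≤ totalEnergy A R η) := by
  induction m with
  | zero =>
    refine ⟨{0}, 1 / 2, Finset.singleton_nonempty _, by norm_num, by norm_num, ?_, ?_, .inr ?_⟩
    · rw [Finset.card_singleton]
      exact Nat.one_le_of_lt (lt_tower _)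
    · have : (256 : ℝ) ≤ tower h := by exact_mod_cast hh
      norm_num
      linarith
    · rw [Nat.cast_zero, zero_mul]
      exact Finset.sum_nonneg fun i _ => Finset.sum_nonneg fun x _ => sq_nonneg _
  | succ m ih =>
    obtain ⟨R, η, hR, hη, hη1, hRD, hηD, hreg⟩ := ih
    have hmono : tower h ≤ tower (h + 2 * m) := tower_mono (by omega)
    have hmono' : tower (h + 2 * m) ≤ tower (h + 2 * (m + 1)) := tower_mono (by omega)
    by_cases hA : ∀ i, IsRegularPair k ε R η (A i)
    · exact ⟨R, η, hR, hη, hη1, hRD.trans hmono',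
        hηD.trans (by exact_mod_cast hmono'), .inl hA⟩
    · have hE := hreg.resolve_left hA
      push Not at hA
      obtain ⟨i, hi⟩ := hA
      obtain ⟨S, hRS, hcard, hinc⟩ := exists_totalEnergy_increment hk hε hε1 hR hη hη1.le hi
      have hS := hR.mono hRS
      have hη₂ := eta2_pos hk hε hR hη
      have hle₂ := eta2_le hk hε hε1 hR hη
      have hle₃ := eta2_le hk hε hε1 hS hη₂
      obtain ⟨h1, h2⟩ := growth_le hk (hkh.trans hmono) hε
        (hεh.trans (by exact_mod_cast hmono)) (hh.trans hmono) hR hRD hη hηD hS hcard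
      have hT : tower (h + 2 * (m + 1)) = 2 ^ 2 ^ tower (h + 2 * m) := rfl
      refine ⟨S, _, hS, eta2_pos hk hε hS hη₂, by linarith, ?_, ?_, .inr ?_⟩
      · rw [hT]
        exact_mod_cast h1
      · rw [hT]
        exact_mod_cast h2
      · push_cast
        linarith

lemma isRegularPair_of_one_lt {k : ℕ} {ε : ℝ} (hε : 1 < ε) (R : Finset (AddChar G ℂ)) (η : ℝ)
    (A : Set G) : IsRegularPair k ε R η A := by
  have h1 : (Set.ncard {x : G | ¬ IsRegularValue k ε R η A x} : ℝ) ≤ Fintype.card G := by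
    rw [← Nat.card_eq_fintype_card]
    exact_mod_cast Set.ncard_le_card _
  have h2 : (0 : ℝ) < Fintype.card G := by exact_mod_cast Fintype.card_pos
  refine h1.trans_lt ?_
  nlinarith

end AbelianRegularity

open AbelianRegularity in
theorem theorem5p3 {G : Type*} [AddCommGroup G] [Fintype G] (k : ℕ) (hk : 1 ≤ k)
    (ε : ℝ) (hε : 0 < ε) (A : Fin k → Set G) :
    ∃ (R : Finset (AddChar G ℂ)) (η : ℝ),
      R.Nonempty ∧ 0 < η ∧ η < 1 ∧
      (R.card : ℝ) ≤ AbelianRegularity.W (2 ^ 11 * (k : ℝ) ^ 2 * ε ^ (-3 : ℤ)) ∧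
      1 / AbelianRegularity.W (2 ^ 11 * (k : ℝ) ^ 2 * ε ^ (-3 : ℤ)) ≤ η ∧
      ∀ i : Fin k, AbelianRegularity.IsRegularPair k ε R η (A i) := by
  have hk1 : (1 : ℝ) ≤ k := by exact_mod_cast hk
  have hW : ∀ n : ℕ, (n : ℝ) < 2 ^ 11 * (k : ℝ) ^ 2 * ε ^ (-3 : ℤ) + 1 →
      (tower n : ℝ) ≤ W (2 ^ 11 * (k : ℝ) ^ 2 * ε ^ (-3 : ℤ)) := by
    intro n hn
    have h1 : n < ⌈2 ^ 11 * (k : ℝ) ^ 2 * ε ^ (-3 : ℤ)⌉₊ + 1 := by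
      have := hn.trans_le (add_le_add_left (Nat.le_ceil _) _)
      exact_mod_cast this
    rw [W]
    exact_mod_cast tower_mono (Nat.lt_succ_iff.1 h1)
  rcases lt_or_ge 1 ε with hε1 | hε1
  -- For `1 < ε` every pair is regular, since fewer than `ε |G|` points exist.
  · have h2 : (2 : ℝ) ≤ W (2 ^ 11 * (k : ℝ) ^ 2 * ε ^ (-3 : ℤ)) := by
      refine le_trans ?_ (hW 1 ?_)
      · norm_num [tower]
      · push_cast
        linarith [show 0 < 2 ^ 11 * (k : ℝ) ^ 2 * ε ^ (-3 : ℤ) by positivity]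
    refine ⟨{0}, 1 / 2, Finset.singleton_nonempty _, by norm_num, by norm_num, ?_, ?_,
      fun i => isRegularPair_of_one_lt hε1 _ _ _⟩
    · rw [Finset.card_singleton]
      push_cast
      linarith
    · exact one_div_le_one_div_of_le two_pos h2
  -- The tower of height `h` dominates `k`, `1 / ε` and `256`; `m` steps would push the total
  -- energy above `k |G|`.
  · set h := k + ⌈1 / ε⌉₊ + 4 with hh
    set m := ⌊16 * k / ε ^ 3⌋₊ + 1 with hm
    have hεinv : 1 ≤ 1 / ε := by rwa [one_le_div hε]
    have hlt : (h : ℝ) < tower h := by exact_mod_cast lt_tower h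
    obtain ⟨R, η, hR, hη, hη1, hRD, hηD, hreg⟩ := exists_regular_or_large_energy hk hε hε1 A
      (h := h) ((by omega : k ≤ h).trans (lt_tower h).le)
      (by
        have := Nat.le_ceil (1 / ε)
        rw [hh] at hlt ⊢
        push_cast at hlt
        linarith)
      ((by norm_num [tower] : 256 ≤ tower 4).trans (tower_mono (by omega))) m
    have hheight : ((h + 2 * m : ℕ) : ℝ) < 2 ^ 11 * (k : ℝ) ^ 2 * ε ^ (-3 : ℤ) + 1 := by
      have h1 := Nat.ceil_lt_add_one (a := 1 / ε) (by positivity)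
      have h2 := Nat.floor_le (a := 16 * k / ε ^ 3) (by positivity)
      have h3 : ε ^ (-3 : ℤ) = (1 / ε) ^ 3 := by
        rw [zpow_neg, one_div, inv_pow]
        norm_cast
      have h4 : 16 * (k : ℝ) / ε ^ 3 = 16 * k * (1 / ε) ^ 3 := by
        rw [one_div, inv_pow, div_eq_mul_inv]
      rw [h4] at h2
      have h5 : 1 / ε ≤ (1 / ε) ^ 3 := le_self_pow₀ hεinv (by norm_num)
      have h6 : (k : ℝ) ≤ k ^ 2 := le_self_pow₀ hk1 (by norm_num)
      have h7 : (k : ℝ) * (1 / ε) ^ 3 ≤ k ^ 2 * (1 / ε) ^ 3 := by gcongr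
      have h8 : (k : ℝ) ^ 2 * 1 ≤ k ^ 2 * (1 / ε) ^ 3 := by
        gcongr
        exact hεinv.trans h5
      have h9 : 1 * (1 / ε) ^ 3 ≤ (k : ℝ) * (1 / ε) ^ 3 := by gcongr
      rw [h3, hh, hm]
      push_cast
      rw [h4]
      linarith
    have hRW := hW _ hheight
    refine ⟨R, η, hR, hη, hη1, le_trans (by exact_mod_cast hRD) hRW, ?_,
      hreg.resolve_right fun hE => ?_⟩
    · have h1 := (hηD.trans hRW)
      rw [one_div_le (lt_of_lt_of_le (by positivity) h1) hη]
      exact h1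
    · have h1 := hE.trans (totalEnergy_le A R hη)
      have hN : (0 : ℝ) < Fintype.card G := by exact_mod_cast Fintype.card_pos
      have h2 : (m : ℝ) * (ε ^ 3 / 16) ≤ k := by
        rw [← mul_assoc] at h1
        exact le_of_mul_le_mul_right h1 hN
      have h3 : 16 * k / ε ^ 3 < m := by
        rw [hm]
        push_cast
        exact Nat.lt_floor_add_one _
      rw [div_lt_iff₀ (by positivity)] at h3
      linarith
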